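/- Let $G$ be a finite group. A generating set $X$ of $G$ is called minimal if no proper subset of $X$ generates $G$. For a positive integer $u$, let $\Gamma_u(G)$ be the graph whose vertices are the elements of $G$ and in which two vertices $x$ and $y$ are adjacent if and only if $x\neq y$ and there exists a minimal generating set of $G$ of size exactly $u$ containing both $x$ and $y$. Let $V_u(G)$ be the set of non-isolated vertices of $\Gamma_u(G)$, and let $\Delta_u(G)$ be the subgraph of $\Gamma_u(G)$ induced by $V_u(G)$. Theorem. For every positive integer $u$ and every finite soluble group $G$, the graph $\Delta_u(G)$ is connected, that is, any two vertices of $\Delta_u(G)$ are joined by a path in $\Delta_u(G)$. (The graph with no vertices, which occurs when $V_u(G)=\emptyset$, is counted as connected.) -/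

import Mathlib

/-- A generating set `X` of `G` is minimal if no proper subset of `X` generates `G`. -/
def IsMinimalGeneratingSet {G : Type*} [Group G] (X : Set G) : Prop :=
  Subgroup.closure X = ⊤ ∧ ∀ Y : Set G, Y ⊂ X → Subgroup.closure Y ≠ ⊤

/-- The graph `Γ_u(G)`: the vertices are all the elements of `G`, and `x ≠ y` are adjacent when
some minimal generating set of `G` of size exactly `u` contains both. -/
def independenceGraph (u : ℕ) (G : Type*) [Group G] : SimpleGraph G where
  Adj x y := x ≠ y ∧ ∃ X : Set G, IsMinimalGeneratingSet X ∧ X.encard = u ∧ x ∈ X ∧ y ∈ X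
  symm := ⟨fun _ _ h =>
    ⟨h.1.symm, h.2.imp fun _ hX => ⟨hX.1, hX.2.1, hX.2.2.2, hX.2.2.1⟩⟩⟩
  loopless := ⟨fun _ h => h.1 rfl⟩

/-- The set `V_u(G)` of the non-isolated vertices of `Γ_u(G)`. -/
def nonIsolatedVertices (u : ℕ) (G : Type*) [Group G] : Set G :=
  {x | ∃ y, (independenceGraph u G).Adj x y}

/-- The graph `Δ_u(G)`: the subgraph of `Γ_u(G)` induced by its non-isolated vertices. -/
def reducedIndependenceGraph (u : ℕ) (G : Type*) [Group G] :
    SimpleGraph (nonIsolatedVertices u G) :=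
  (independenceGraph u G).induce (nonIsolatedVertices u G)

/-!
Let `u ≥ 2`. The claim is that any two minimal generating tuples of length `u` are joined by a chain
of such tuples in which neighbours share an entry. The proof is by induction along a chief series.
Let `N` be an abelian minimal normal subgroup of `G`. A tuple that generates `G` modulo `N` either
generates `G` or lies in a complement of `N` (`exists_splitting`). Complements are handled through
the homomorphic sections `s : G ⧸ N →* G`, for which `s₁ s₂⁻¹ s₃` is again a section.

A minimal generating tuple of `G` either remains minimal modulo `N`, or consists of a minimal
generating tuple of a complement and one further element (`IsMinGen.mk_or`). In the second case the
further element can be any nontrivial element of `N`, so all tuples of this kind are linked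
(`linked_of_not_isMinGen_mk`).

For the tuples of the first kind, chains in `G ⧸ N` are lifted. By Gaschütz's lemma
(`exists_lift_iff`), whether a tuple of `G ⧸ N` has a generating lift, or one with a prescribed
entry, does not depend on the rest of the tuple; it remains to link two generating lifts `v`, `w` of
the same tuple. For `u ≥ 3`, mixtures of `v` and `w` do this (`linked_of_three_le`). For `u = 2`,
where `G` may be assumed not to be cyclic, a pair `a`, `b` is replaced by `a`, `a * b` or by `b`,
`a * b` in a suitable way (`linked_of_pair`).

When both kinds occur, a tuple of the first kind is linked to one of the second kind
(`exists_linked_of_isMinGen_mk`). This uses that a soluble group with minimal generating tuples of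
lengths `k` and `k + 1`, where `k ≥ 2`, has two such tuples with a common entry
(`exists_common_entry`).
-/

open Subgroup

/-! ### Minimal generating tuples -/

/-- The tuple `g` generates `G`, and no longer does so when one of its entries is omitted.
Minimal generating sets are indexed so that they can be lifted entry by entry along `G → G ⧸ N`. -/
def IsMinGen {ι G : Type*} [Group G] (g : ι → G) : Prop :=
  closure (Set.range g) = ⊤ ∧ ∀ i, closure (g '' {i}ᶜ) ≠ ⊤

section MinGen

variable {ι G : Type*} [Group G]

theorem IsMinGen.injective {g : ι → G} (hg : IsMinGen g) : Function.Injective g := by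
  intro i j hij
  by_contra hne
  refine hg.2 i (top_unique ?_)
  rw [← hg.1]
  refine closure_mono ?_
  rintro _ ⟨l, rfl⟩
  by_cases hl : l = i
  · exact ⟨j, fun h => hne h.symm, by rw [hl, hij]⟩
  · exact ⟨l, hl, rfl⟩

theorem range_comp_succAbove {α : Type*} {k : ℕ} (g : Fin (k + 1) → α) (i : Fin (k + 1)) :
    Set.range (g ∘ i.succAbove) = g '' {i}ᶜ := by
  rw [Set.range_comp, Fin.range_succAbove]

theorem map_closure_range {G' : Type*} [Group G'] (f : G →* G') (g : ι → G) :
    (closure (Set.range g)).map f = closure (Set.range (f ∘ g)) := by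
  rw [MonoidHom.map_closure, Set.range_comp]

theorem closure_range_comp_eq_top {G' : Type*} [Group G'] {f : G →* G'}
    (hf : Function.Surjective f) {g : ι → G} (hg : closure (Set.range g) = ⊤) :
    closure (Set.range (f ∘ g)) = ⊤ := by
  rw [← map_closure_range, hg, ← MonoidHom.range_eq_map, MonoidHom.range_eq_top.2 hf]

/-- A generating tuple whose image in a quotient is a minimal generating tuple is minimal. -/
theorem IsMinGen.of_comp {G' : Type*} [Group G'] {f : G →* G'}
    (hf : Function.Surjective f) {g : ι → G} (hg : closure (Set.range g) = ⊤)
    (h : IsMinGen (f ∘ g)) : IsMinGen g := by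
  refine ⟨hg, fun i hi => h.2 i ?_⟩
  rw [Set.image_comp, ← MonoidHom.map_closure, hi, ← MonoidHom.range_eq_map,
    MonoidHom.range_eq_top.2 hf]

end MinGen

/-! ### Splittings over an abelian minimal normal subgroup -/

/-- `N` is a nontrivial abelian subgroup that contains no nontrivial normal subgroup of `G`
except itself; for normal `N`, it is an abelian minimal normal subgroup. -/
structure IsAbelianMinimal {G : Type*} [Group G] (N : Subgroup G) : Prop where
  ne_bot : N ≠ ⊥
  comm : ∀ x ∈ N, ∀ y ∈ N, x * y = y * x
  eq_of_le : ∀ M : Subgroup G, M.Normal → M ≤ N → M ≠ ⊥ → M = N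

theorem IsAbelianMinimal.exists_ne_one {G : Type*} [Group G] {N : Subgroup G}
    (hN : IsAbelianMinimal N) : ∃ n ∈ N, n ≠ 1 :=
  (Subgroup.ne_bot_iff_exists_ne_one.1 hN.ne_bot).elim
    fun n hn => ⟨n, n.2, fun h => hn (Subtype.ext h)⟩

theorem exists_isAbelianMinimal {G : Type*} [Group G] [Finite G] [Nontrivial G]
    (hG : Group.IsSolvable G) : ∃ N : Subgroup G, N.Normal ∧ IsAbelianMinimal N := by
  obtain ⟨N, -, hN⟩ := Set.Finite.exists_le_minimal
    (s := {M : Subgroup G | M.Normal ∧ M ≠ ⊥}) (Set.toFinite _) (a := ⊤)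
    ⟨inferInstance, bot_ne_top.symm⟩
  have hn : N.Normal := hN.prop.1
  refine ⟨N, hn, hN.prop.2, ?_, fun M h1 h2 h3 => le_antisymm h2 (hN.2 ⟨h1, h3⟩ h2)⟩
  have hlt := Group.IsSolvable.commutator_lt_of_ne_bot hN.prop.2
  have hbot : ⁅N, N⁆ = ⊥ := by
    by_contra hne
    exact absurd (hN.2 ⟨inferInstance, hne⟩ hlt.le) (not_le_of_gt hlt)
  intro x hx y hy
  have := commutator_mem_commutator hx hy
  rw [hbot, mem_bot] at this
  exact commutatorElement_eq_one_iff_mul_comm.1 this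

/-- The homomorphic sections of `G → G ⧸ N`. Such a section is determined by its range, and the
ranges are exactly the complements of `N` in `G`. -/
abbrev Splitting {G : Type*} [Group G] (N : Subgroup G) [N.Normal] :=
  {s : G ⧸ N →* G // ∀ q, (s q : G ⧸ N) = q}

section Splitting

variable {ι G : Type*} [Group G] {N : Subgroup G} [N.Normal]

instance [Finite G] : Finite (Splitting N) := by
  have : Finite (G ⧸ N →* G) := DFunLike.finite _
  infer_instance

theorem Splitting.inv_mul_mem (s : Splitting N) (x : G) : x⁻¹ * s.1 x ∈ N := by
  rw [← QuotientGroup.eq, s.2]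

theorem Splitting.eq_one_of_mem_range (s : Splitting N) {n : G} (hn : n ∈ N)
    (h : n ∈ s.1.range) : n = 1 := by
  obtain ⟨q, rfl⟩ := h
  rw [← QuotientGroup.eq_one_iff, s.2] at hn
  rw [hn, map_one]

theorem Splitting.range_ne_top (hN : IsAbelianMinimal N) (s : Splitting N) :
    s.1.range ≠ ⊤ := by
  intro h
  obtain ⟨n, hn, h1⟩ := hN.exists_ne_one
  exact h1 (s.eq_one_of_mem_range hn (h ▸ mem_top n))

/-- A subgroup that covers `G ⧸ N` meets `N` in a normal subgroup of `G`, because `N` is abelian;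
so it is `G` as soon as this intersection is not trivial. -/
theorem IsAbelianMinimal.eq_top (hN : IsAbelianMinimal N) {L : Subgroup G}
    (hL : ∀ g : G, ∃ l ∈ L, (l : G ⧸ N) = g) (h : L ⊓ N ≠ ⊥) : L = ⊤ := by
  have hnormal : (L ⊓ N).Normal := by
    refine ⟨fun x hx g => ?_⟩
    obtain ⟨l, hl, hlg⟩ := hL g
    have hn : l⁻¹ * g ∈ N := QuotientGroup.eq.1 hlg
    have hc := hN.comm _ hn _ hx.2
    have : g * x * g⁻¹ = l * x * l⁻¹ := by
      calc g * x * g⁻¹ = l * (l⁻¹ * g * x) * g⁻¹ := by group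
        _ = l * x * l⁻¹ := by rw [hc]; group
    rw [this]
    exact ⟨L.mul_mem (L.mul_mem hl hx.1) (L.inv_mem hl), ‹N.Normal›.conj_mem _ hx.2 _⟩
  have hle : N ≤ L := (hN.eq_of_le _ hnormal inf_le_right h) ▸ inf_le_left
  refine top_unique fun g _ => ?_
  obtain ⟨l, hl, hlg⟩ := hL g
  have := L.mul_mem hl (hle (QuotientGroup.eq.1 hlg))
  simpa using this

theorem exists_mem_closure_mk_eq {g : ι → G}
    (hg : closure (Set.range (QuotientGroup.mk' N ∘ g)) = ⊤) (x : G) :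
    ∃ l ∈ closure (Set.range g), (l : G ⧸ N) = x := by
  rw [← map_closure_range] at hg
  obtain ⟨l, hl, h⟩ := mem_map.1 (hg ▸ mem_top (x : G ⧸ N))
  exact ⟨l, hl, h⟩

/-- A tuple that generates `G` modulo `N` generates `G`, unless it lies in a complement of `N`. -/
theorem exists_splitting (hN : IsAbelianMinimal N) {g : ι → G}
    (hg : closure (Set.range (QuotientGroup.mk' N ∘ g)) = ⊤)
    (hne : closure (Set.range g) ≠ ⊤) : ∃ s : Splitting N, ∀ i, s.1 (g i) = g i := by
  set L := closure (Set.range g) with hLdef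
  have hL : ∀ x : G, ∃ l ∈ L, (l : G ⧸ N) = x := exists_mem_closure_mk_eq hg
  have hbot : L ⊓ N = ⊥ := by
    by_contra h
    exact hne (hN.eq_top hL h)
  have hbij : Function.Bijective ((QuotientGroup.mk' N).comp L.subtype) := by
    constructor
    · rw [injective_iff_map_eq_one]
      intro a ha
      have : (a : G) ∈ L ⊓ N := ⟨a.2, (QuotientGroup.eq_one_iff _).1 ha⟩
      rw [hbot, mem_bot] at this
      exact Subtype.ext this
    · intro q
      induction q using QuotientGroup.induction_on with
      | H x =>
        obtain ⟨l, hl, h⟩ := hL x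
        exact ⟨⟨l, hl⟩, h⟩
  let e := MulEquiv.ofBijective _ hbij
  refine ⟨⟨L.subtype.comp e.symm.toMonoidHom, fun q => e.apply_symm_apply q⟩, fun i => ?_⟩
  have : e.symm (g i : G ⧸ N) = ⟨g i, subset_closure ⟨i, rfl⟩⟩ := by
    rw [MulEquiv.symm_apply_eq]; rfl
  change ((e.symm (g i : G ⧸ N) : L) : G) = g i
  rw [this]

theorem Splitting.closure_ne_top (hN : IsAbelianMinimal N) (s : Splitting N) {g : ι → G}
    (hs : ∀ i, s.1 (g i) = g i) : closure (Set.range g) ≠ ⊤ := by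
  refine fun h => s.range_ne_top hN (top_unique (h ▸ ?_))
  rw [closure_le]
  rintro _ ⟨i, rfl⟩
  exact ⟨_, hs i⟩

/-- Complements of `N` are maximal subgroups. -/
theorem Splitting.eq_top_of_range_le (hN : IsAbelianMinimal N) (s : Splitting N) {L : Subgroup G}
    (hL : s.1.range ≤ L) {x : G} (hx : x ∈ L) (hxs : s.1 x ≠ x) : L = ⊤ := by
  refine hN.eq_top (fun g => ⟨s.1 g, hL ⟨_, rfl⟩, s.2 _⟩) fun h => hxs ?_
  have : x⁻¹ * s.1 x ∈ L ⊓ N := ⟨L.mul_mem (L.inv_mem hx) (hL ⟨_, rfl⟩), s.inv_mul_mem x⟩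
  rw [h, mem_bot, inv_mul_eq_one] at this
  exact this.symm

/-- Crossed homomorphisms to the abelian group `N` form a group; in terms of sections,
`s₁ s₂⁻¹ s₃` is again a section. -/
def Splitting.triple (hN : IsAbelianMinimal N) (s₁ s₂ s₃ : Splitting N) : Splitting N where
  val := MonoidHom.mk' (fun q => s₁.1 q * (s₂.1 q)⁻¹ * s₃.1 q) fun p q => by
    have hmem : ∀ q, (s₂.1 q)⁻¹ * s₃.1 q ∈ N := fun q => by
      rw [← QuotientGroup.eq, s₂.2, s₃.2]
    have hmem' : ∀ q, s₁.1 q * (s₂.1 q)⁻¹ ∈ N := fun q => by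
      rw [← QuotientGroup.eq_one_iff, QuotientGroup.mk_mul, QuotientGroup.mk_inv, s₁.2, s₂.2,
        mul_inv_cancel]
    -- Both factors below lie in `N`, the second one as a conjugate, so that they commute.
    have hc := hN.comm _ (hmem p) _ (hmem' q)
    simp only [map_mul, mul_inv_rev]
    calc s₁.1 p * s₁.1 q * ((s₂.1 q)⁻¹ * (s₂.1 p)⁻¹) * (s₃.1 p * s₃.1 q)
        = s₁.1 p * (s₁.1 q * (s₂.1 q)⁻¹ * ((s₂.1 p)⁻¹ * s₃.1 p)) * s₃.1 q := by group
      _ = _ := by rw [← hc]; group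
  property q := by
    change ((s₁.1 q * (s₂.1 q)⁻¹ * s₃.1 q : G) : G ⧸ N) = q
    rw [QuotientGroup.mk_mul, QuotientGroup.mk_mul, QuotientGroup.mk_inv, s₁.2, s₂.2, s₃.2]
    group

theorem Splitting.triple_apply (hN : IsAbelianMinimal N) (s₁ s₂ s₃ : Splitting N) (q : G ⧸ N) :
    (s₁.triple hN s₂ s₃).1 q = s₁.1 q * (s₂.1 q)⁻¹ * s₃.1 q := rfl

/-- Gaschütz's lemma. Whether a tuple that generates `G` modulo `N` can be made to generate `G` by
changing its entries outside `J` modulo `N` depends only on the number of complements of `N` that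
contain its entries in `J`. -/
theorem exists_lift_iff [Finite G] [Finite ι] (hN : IsAbelianMinimal N) {f : ι → G}
    (hf : closure (Set.range (QuotientGroup.mk' N ∘ f)) = ⊤) (J : Set ι) :
    (∃ g : ι → G, QuotientGroup.mk' N ∘ g = QuotientGroup.mk' N ∘ f ∧ (∀ j ∈ J, g j = f j) ∧
      closure (Set.range g) = ⊤) ↔
    Nat.card {s : Splitting N // ∀ j ∈ J, s.1 (f j) = f j} <
      Nat.card N ^ Nat.card (Jᶜ : Set ι) := by
  classical
  have := Fintype.ofFinite ι
  rw [← Nat.card_fun]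
  -- Lifts that agree with `f` on `J` are `N`-valued functions on `Jᶜ`.
  let lift (ν : (Jᶜ : Set ι) → N) : ι → G := fun i =>
    if h : i ∈ J then f i else f i * ν ⟨i, h⟩
  have hlift : ∀ ν, QuotientGroup.mk' N ∘ lift ν = QuotientGroup.mk' N ∘ f := by
    intro ν
    funext i
    by_cases h : i ∈ J
    · simp [lift, h]
    · simp [lift, h]
  have hliftJ : ∀ ν, ∀ j ∈ J, lift ν j = f j := fun ν j hj => by simp [lift, hj]
  let res (s : {s : Splitting N // ∀ j ∈ J, s.1 (f j) = f j}) : (Jᶜ : Set ι) → N :=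
    fun i => ⟨(f i)⁻¹ * s.1.1 (f i), s.1.inv_mul_mem _⟩
  have hres : ∀ s i, lift (res s) i = s.1.1 (f i) := by
    intro s i
    by_cases h : i ∈ J
    · simp [lift, h, s.2 i h]
    · simp [lift, h, res]
  constructor
  · rintro ⟨g, hgf, hgJ, hg⟩
    have hmk : ∀ i, (g i : G ⧸ N) = f i := fun i => congrFun hgf i
    have hinj : Function.Injective res := by
      intro s t hst
      refine Subtype.ext (Subtype.ext (MonoidHom.eq_of_eqOn_dense hf ?_))
      rintro _ ⟨i, rfl⟩
      have := congrArg (fun ν => lift ν i) hst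
      simp only [hres] at this
      exact this
    refine lt_of_le_of_ne (Nat.card_le_card_of_injective _ hinj) fun hcard => ?_
    have hsurj := (Function.Injective.bijective_of_nat_card_le hinj hcard.ge).2
    obtain ⟨s, hs⟩ := hsurj fun i => ⟨(f i)⁻¹ * g i, QuotientGroup.eq.1 (hmk i).symm⟩
    refine s.1.closure_ne_top hN (g := g) (fun i => ?_) hg
    rw [hmk, ← hres, hs]
    by_cases h : i ∈ J
    · simp [lift, h, hgJ i h]
    · simp [lift, h]
  · intro hlt
    by_contra! hbad
    refine absurd hlt (not_lt.2 ?_)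
    have hex : ∀ ν, ∃ s : Splitting N, ∀ i, s.1 (f i) = lift ν i := by
      intro ν
      obtain ⟨s, hs⟩ := exists_splitting hN (g := lift ν) (by rw [hlift, hf])
        (hbad _ (hlift ν) (hliftJ ν))
      refine ⟨s, fun i => ?_⟩
      have : (f i : G ⧸ N) = lift ν i := (congrFun (hlift ν) i).symm
      rw [this, hs]
    choose s hs using hex
    refine Nat.card_le_card_of_injective
      (fun ν => ⟨s ν, fun j hj => by rw [hs, hliftJ ν j hj]⟩) fun ν μ h => ?_
    have h' : s ν = s μ := congrArg Subtype.val h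
    funext i
    have := (hs ν i).symm.trans (h' ▸ hs μ i)
    have hi : (i : ι) ∉ J := i.2
    simpa [lift, hi] using this

end Splitting

/-! ### Chains of minimal generating tuples -/

/-- Some minimal generating tuple of length `k` contains both `a` and `b`. This differs from
adjacency in the independence graph only in that `a = b` is allowed. -/
def MinGenAdj {G : Type*} [Group G] (k : ℕ) (a b : G) : Prop :=
  ∃ g : Fin k → G, IsMinGen g ∧ a ∈ Set.range g ∧ b ∈ Set.range g

/-- The elements `a` and `b` are joined by a chain of minimal generating tuples of length `k`. -/
def MinGenLinked {G : Type*} [Group G] (k : ℕ) : G → G → Prop :=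
  Relation.ReflTransGen (MinGenAdj k)

section Linked

variable {G : Type*} [Group G] {k : ℕ} {a b c : G}

theorem MinGenAdj.symm (h : MinGenAdj k a b) : MinGenAdj k b a :=
  h.imp fun _ hg => ⟨hg.1, hg.2.2, hg.2.1⟩

theorem MinGenAdj.linked (h : MinGenAdj k a b) : MinGenLinked k a b :=
  Relation.ReflTransGen.single h

theorem IsMinGen.adj {g : Fin k → G} (hg : IsMinGen g) (i j : Fin k) : MinGenAdj k (g i) (g j) :=
  ⟨g, hg, ⟨i, rfl⟩, ⟨j, rfl⟩⟩

theorem IsMinGen.linked {g : Fin k → G} (hg : IsMinGen g) (i j : Fin k) :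
    MinGenLinked k (g i) (g j) :=
  (hg.adj i j).linked

theorem MinGenLinked.symm (h : MinGenLinked k a b) : MinGenLinked k b a :=
  (have : Std.Symm (MinGenAdj (G := G) k) := ⟨fun _ _ h => h.symm⟩
  Relation.ReflTransGen.stdSymm).symm _ _ h

theorem MinGenLinked.trans (h : MinGenLinked k a b) (h' : MinGenLinked k b c) :
    MinGenLinked k a c :=
  Relation.ReflTransGen.trans h h'

end Linked

/-! ### Linking the generating lifts of a fixed minimal generating tuple -/

section Lifts

variable {G : Type*} [Group G] {N : Subgroup G} [N.Normal] {k : ℕ}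

theorem IsMinGen.of_lift {ι : Type*} {g f : ι → G} (hf : IsMinGen (QuotientGroup.mk' N ∘ f))
    (hgf : QuotientGroup.mk' N ∘ g = QuotientGroup.mk' N ∘ f)
    (hg : closure (Set.range g) = ⊤) : IsMinGen g :=
  IsMinGen.of_comp (QuotientGroup.mk'_surjective N) hg (hgf ▸ hf)

/-- For generating lifts `v` and `w` of one tuple, any generating lift that shares the entry `i`
with `v` and another entry with `w` links `v i` to `w i`. If there is none, three mixtures of `v`
and `w` lie in complements of `N`, and these complements combine to one that contains `v`. -/
theorem linked_of_three_le (hN : IsAbelianMinimal N) (hk : 3 ≤ k) {v w : Fin k → G}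
    (hmin : IsMinGen (QuotientGroup.mk' N ∘ v))
    (hvw : QuotientGroup.mk' N ∘ w = QuotientGroup.mk' N ∘ v)
    (hv : closure (Set.range v) = ⊤) (hw : closure (Set.range w) = ⊤) (i : Fin k) :
    MinGenLinked k (v i) (w i) := by
  by_contra hcon
  have hmk : ∀ p, (w p : G ⧸ N) = v p := fun p => congrFun hvw p
  have key : ∀ g : Fin k → G, (∀ p, g p = v p ∨ g p = w p) → g i = v i →
      (∃ j, g j = w j) → ∃ s : Splitting N, ∀ p, s.1 (v p) = g p := by
    rintro g hg hgi ⟨j, hgj⟩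
    have hgmk : ∀ p, (g p : G ⧸ N) = v p := fun p => by
      rcases hg p with h | h <;> simp [h, hmk]
    have hgv : QuotientGroup.mk' N ∘ g = QuotientGroup.mk' N ∘ v := funext hgmk
    obtain ⟨s, hs⟩ := exists_splitting hN (g := g) (hgv ▸ hmin.1) fun hgen => hcon <| by
      have hg' := hmin.of_lift hgv hgen
      have hw' := hmin.of_lift hvw hw
      exact hgi ▸ (hg'.linked i j).trans (hgj ▸ hw'.linked j i)
    exact ⟨s, fun p => by rw [← hgmk, hs]⟩
  obtain ⟨j, hji⟩ : ∃ j : Fin k, j ≠ i :=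
    Fintype.exists_ne_of_one_lt_card (by simp; omega) i
  obtain ⟨l, hl⟩ : ∃ l : Fin k, l ∉ ({i, j} : Finset (Fin k)) := by
    by_contra! h
    have h1 := Finset.card_le_card (fun x _ => h x : Finset.univ ⊆ {i, j})
    have h2 := Finset.card_le_two (a := i) (b := j)
    simp only [Finset.card_univ, Fintype.card_fin] at h1
    omega
  simp only [Finset.mem_insert, Finset.mem_singleton, not_or] at hl
  obtain ⟨s₁, h₁⟩ := key (fun p => if p = j then w p else v p)
    (fun p => by split_ifs <;> simp) (by simp [hji.symm]) ⟨j, by simp⟩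
  obtain ⟨s₂, h₂⟩ := key (fun p => if p = j ∨ p = l then w p else v p)
    (fun p => by split_ifs <;> simp)
    (by simp [hji.symm, Ne.symm hl.1]) ⟨j, by simp⟩
  obtain ⟨s₃, h₃⟩ := key (fun p => if p = l then w p else v p)
    (fun p => by split_ifs <;> simp) (by simp [Ne.symm hl.1]) ⟨l, by simp⟩
  refine (s₁.triple hN s₂ s₃).closure_ne_top hN (g := v) (fun p => ?_) hv
  rw [Splitting.triple_apply, h₁, h₂, h₃]
  by_cases hpj : p = j
  · subst hpj
    simp [Ne.symm hl.2]
  · by_cases hpl : p = l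
    · subst hpl
      simp [hpj]
    · simp [hpj, hpl]

theorem minGenAdj_two (hcyc : ∀ z : G, closure {z} ≠ ⊤) {x y : G}
    (h : closure {x, y} = ⊤) : MinGenAdj 2 x y := by
  have hr : Set.range ![x, y] = {x, y} := by simp [Set.pair_comm]
  refine ⟨![x, y], ⟨hr ▸ h, fun i hi => ?_⟩, by simp, by simp⟩
  refine hcyc (![x, y] (1 - i)) (top_unique (hi ▸ closure_mono ?_))
  rintro _ ⟨j, hj, rfl⟩
  have : j = 1 - i := by
    have hj' : j ≠ i := hj
    lia
  rw [this]; rfl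

/-- Two elements that lie in a common complement of `N`. -/
def InCommonComplement (N : Subgroup G) [N.Normal] (x y : G) : Prop :=
  ∃ s : Splitting N, s.1 x = x ∧ s.1 y = y

theorem InCommonComplement.triple (hN : IsAbelianMinimal N) {x x' y y' : G}
    (hx : (x : G ⧸ N) = x') (hy : (y : G ⧸ N) = y') (h₁ : InCommonComplement N x y)
    (h₂ : InCommonComplement N x' y) (h₃ : InCommonComplement N x' y') :
    InCommonComplement N x y' := by
  obtain ⟨s₁, h₁, h₁'⟩ := h₁
  obtain ⟨s₂, h₂, h₂'⟩ := h₂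
  obtain ⟨s₃, h₃, h₃'⟩ := h₃
  refine ⟨s₁.triple hN s₂ s₃, ?_, ?_⟩ <;> rw [Splitting.triple_apply]
  · rw [h₁, hx, h₂, h₃, inv_mul_cancel_right]
  · rw [← hy, h₁', h₂', mul_inv_cancel, one_mul, hy, h₃']

theorem closure_pair_eq_top_or (hN : IsAbelianMinimal N) {x y : G}
    (h : closure {(x : G ⧸ N), (y : G ⧸ N)} = ⊤) :
    closure {x, y} = ⊤ ∨ InCommonComplement N x y := by
  have hr : Set.range ![x, y] = {x, y} := by simp [Set.pair_comm]
  by_cases hg : closure {x, y} = ⊤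
  · exact Or.inl hg
  · obtain ⟨s, hs⟩ := exists_splitting hN (g := ![x, y])
      (by rw [Set.range_comp, hr, Set.image_pair]; exact h) (hr ▸ hg)
    exact Or.inr ⟨s, hs 0, hs 1⟩

theorem InCommonComplement.closure_pair_ne_top (hN : IsAbelianMinimal N) {x y : G}
    (h : InCommonComplement N x y) : closure {x, y} ≠ ⊤ := by
  obtain ⟨s, hx, hy⟩ := h
  have hr : Set.range ![x, y] = {x, y} := by simp [Set.pair_comm]
  exact hr ▸ s.closure_ne_top hN (g := ![x, y]) (by simp [Fin.forall_fin_two, hx, hy])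

theorem closure_pair_mul_right {x y : G} (h : closure {x, y} = ⊤) : closure {x, x * y} = ⊤ := by
  rw [← h]
  refine le_antisymm ?_ ?_ <;> rw [closure_le, Set.pair_subset_iff]
  · exact ⟨subset_closure (by simp),
      mul_mem (subset_closure (by simp)) (subset_closure (by simp))⟩
  · refine ⟨subset_closure (by simp), ?_⟩
    have := mul_mem (inv_mem (subset_closure (by simp : x ∈ ({x, x * y} : Set G))))
      (subset_closure (by simp : x * y ∈ ({x, x * y} : Set G)))
    simpa using this

theorem closure_pair_mul_left {x y : G} (h : closure {x, y} = ⊤) : closure {y, x * y} = ⊤ := by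
  rw [← h]
  refine le_antisymm ?_ ?_ <;> rw [closure_le, Set.pair_subset_iff]
  · exact ⟨subset_closure (by simp),
      mul_mem (subset_closure (by simp)) (subset_closure (by simp))⟩
  · refine ⟨?_, subset_closure (by simp)⟩
    have := mul_mem (subset_closure (by simp : x * y ∈ ({y, x * y} : Set G)))
      (inv_mem (subset_closure (by simp : y ∈ ({y, x * y} : Set G))))
    simpa using this

/-- The pairs of lifts need not be linked among themselves, as the example of two reflections that
generate `S₃`, lifted to `S₃ × C₂`, shows; so the lifts of the product of the two generators are
brought in. If the link fails, the pairs formed by the lifts of any two of the three elements split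
into two classes, and a pair generates exactly if its entries are in the same class. But three
elements `a'`, `b`, `a' * b` of one complement would have to lie in pairwise distinct classes. -/
theorem linked_of_pair (hN : IsAbelianMinimal N) (hcyc : ∀ z : G, closure {z} ≠ ⊤)
    {a a' b b' : G} (ha : (a : G ⧸ N) = a') (hb : (b : G ⧸ N) = b')
    (hab : closure {a, b} = ⊤) (hab' : closure {a', b'} = ⊤) : MinGenLinked 2 a a' := by
  by_contra hcon
  have adj : ∀ {x y : G}, closure {x, y} = ⊤ → MinGenLinked 2 x y :=
    fun h => (minGenAdj_two hcyc h).linked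
  have hgen : closure {(a : G ⧸ N), (b : G ⧸ N)} = ⊤ := by
    have := congrArg (Subgroup.map (QuotientGroup.mk' N)) hab
    rw [MonoidHom.map_closure, Set.image_pair, ← MonoidHom.range_eq_map,
      MonoidHom.range_eq_top.2 (QuotientGroup.mk'_surjective N)] at this
    exact this
  have gen₁ : ∀ {x y : G}, (x : G ⧸ N) = a → (y : G ⧸ N) = b →
      closure {x, y} = ⊤ ∨ InCommonComplement N x y :=
    fun hx hy => closure_pair_eq_top_or hN (by rw [hx, hy, hgen])
  have gen₂ : ∀ {x y : G}, (x : G ⧸ N) = a → (y : G ⧸ N) = a * b →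
      closure {x, y} = ⊤ ∨ InCommonComplement N x y :=
    fun hx hy => closure_pair_eq_top_or hN (by rw [hx, hy, closure_pair_mul_right hgen])
  have gen₃ : ∀ {x y : G}, (x : G ⧸ N) = b → (y : G ⧸ N) = a * b →
      closure {x, y} = ⊤ ∨ InCommonComplement N x y :=
    fun hx hy => closure_pair_eq_top_or hN (by rw [hx, hy, closure_pair_mul_left hgen])
  have hc : ((a * b : G) : G ⧸ N) = a * b := rfl
  have hc' : ((a' * b : G) : G ⧸ N) = a * b := by rw [ha]; rfl
  have hcc : ((a * b : G) : G ⧸ N) = (a' * b : G) := by rw [hc, hc']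
  have g_ac := closure_pair_mul_right hab
  have g_bc := closure_pair_mul_left hab
  have b₁ : InCommonComplement N a' b := (gen₁ ha.symm rfl).resolve_left fun h =>
    hcon ((adj hab).trans (adj h).symm)
  obtain ⟨s, hs, hs'⟩ := b₁
  have hss : s.1 ((a' * b : G) : G ⧸ N) = a' * b := by
    rw [QuotientGroup.mk_mul, map_mul, hs, hs']
  have b₂ : InCommonComplement N a' (a' * b) := ⟨s, hs, hss⟩
  have b₃ : InCommonComplement N b (a' * b) := ⟨s, hs', hss⟩
  have b₄ : InCommonComplement N a' (a * b) := (gen₂ ha.symm hc).resolve_left fun h =>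
    hcon ((adj g_ac).trans (adj h).symm)
  have g_ac' : closure {a, a' * b} = ⊤ := (gen₂ rfl hc').resolve_right fun h =>
    (h.triple hN ha hcc.symm b₂ b₄).closure_pair_ne_top hN g_ac
  have b₅ : InCommonComplement N b' (a * b) := (gen₃ hb.symm hc).resolve_left fun h =>
    hcon (((adj g_ac).trans (adj h).symm).trans (adj hab').symm)
  have b₆ : InCommonComplement N b' (a' * b) := (gen₃ hb.symm hc').resolve_left fun h =>
    hcon (((adj g_ac').trans (adj h).symm).trans (adj hab').symm)
  exact (b₃.triple hN hb hcc.symm b₆ b₅).closure_pair_ne_top hN g_bc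

end Lifts

/-! ### Minimal generating tuples of an extension -/

section Extension

variable {G : Type*} [Group G] {N : Subgroup G} [N.Normal] {k : ℕ}

theorem closure_range_cons_eq_top (hN : IsAbelianMinimal N) (s : Splitting N) {y : Fin k → G ⧸ N}
    (hy : closure (Set.range y) = ⊤) {a : G} (ha : s.1 a ≠ a) :
    closure (Set.range (Fin.cons a (s.1 ∘ y) : Fin (k + 1) → G)) = ⊤ := by
  refine s.eq_top_of_range_le hN ?_ (subset_closure ⟨0, rfl⟩) ha
  rw [MonoidHom.range_eq_map, ← hy, map_closure_range]
  refine closure_mono ?_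
  rintro _ ⟨i, rfl⟩
  exact ⟨i.succ, rfl⟩

/-- If a minimal generating tuple of a complement and an element `a` outside the complement do not
form a minimal generating tuple, then `a` can replace an entry of the tuple. -/
theorem isMinGen_cons_or (hN : IsAbelianMinimal N) (s : Splitting N) {y : Fin k → G ⧸ N}
    (hy : IsMinGen y) {a : G} (ha : s.1 a ≠ a) :
    IsMinGen (Fin.cons a (s.1 ∘ y) : Fin (k + 1) → G) ∨
      ∃ j : Fin k, closure ((Fin.cons a (s.1 ∘ y) : Fin (k + 1) → G) '' {j.succ}ᶜ) = ⊤ := by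
  by_contra! h
  refine h.1 ⟨closure_range_cons_eq_top hN s hy.1 ha, fun i => ?_⟩
  refine Fin.cases ?_ h.2 i
  refine fun h0 => s.range_ne_top hN (top_unique (h0 ▸ ?_))
  rw [closure_le]
  rintro _ ⟨j, hj, rfl⟩
  obtain ⟨j, rfl⟩ := Fin.exists_succ_eq.2 hj
  exact ⟨y j, rfl⟩

/-- A minimal generating tuple of a complement of `N` and a nontrivial element of `N` form a
minimal generating tuple. -/
theorem IsMinGen.cons (hN : IsAbelianMinimal N) (s : Splitting N) {y : Fin k → G ⧸ N}
    (hy : IsMinGen y) {n : G} (hn : n ∈ N) (hn1 : n ≠ 1) :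
    IsMinGen (Fin.cons n (s.1 ∘ y) : Fin (k + 1) → G) := by
  have hmk : (n : G ⧸ N) = 1 := (QuotientGroup.eq_one_iff n).2 hn
  refine (isMinGen_cons_or hN s hy (a := n) (by rw [hmk, map_one]; exact hn1.symm)).resolve_right ?_
  rintro ⟨j, hj⟩
  refine hy.2 j (top_unique ?_)
  have htop : (⊤ : Subgroup (G ⧸ N)) = Subgroup.map (QuotientGroup.mk' N) ⊤ := by
    rw [← MonoidHom.range_eq_map, MonoidHom.range_eq_top.2 (QuotientGroup.mk'_surjective N)]
  rw [htop, ← hj, map_le_iff_le_comap, closure_le]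
  rintro _ ⟨l, hl, rfl⟩
  induction l using Fin.cases with
  | zero =>
    change (n : G ⧸ N) ∈ closure (y '' {j}ᶜ)
    rw [hmk]
    exact one_mem _
  | succ l =>
    change ((s.1 (y l) : G) : G ⧸ N) ∈ closure (y '' {j}ᶜ)
    rw [s.2]
    exact subset_closure ⟨l, fun h => hl (by rw [show l = j from h]; rfl), rfl⟩

/-- A minimal generating tuple of `G` remains one modulo `N`, or all its entries but one form a
minimal generating tuple of a complement of `N`. -/
theorem IsMinGen.mk_or (hN : IsAbelianMinimal N) {A : Fin (k + 1) → G} (hA : IsMinGen A) :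
    IsMinGen (QuotientGroup.mk' N ∘ A) ∨ ∃ (i : Fin (k + 1)) (s : Splitting N),
      (∀ j, s.1 (A (i.succAbove j)) = A (i.succAbove j)) ∧
      IsMinGen (QuotientGroup.mk' N ∘ A ∘ i.succAbove) := by
  have hgen := closure_range_comp_eq_top (QuotientGroup.mk'_surjective N) hA.1
  by_cases h : ∀ i, closure ((QuotientGroup.mk' N ∘ A) '' {i}ᶜ) ≠ ⊤
  · exact Or.inl ⟨hgen, h⟩
  push Not at h
  obtain ⟨i, hi⟩ := h
  rw [← range_comp_succAbove] at hi
  obtain ⟨s, hs⟩ := exists_splitting hN (g := A ∘ i.succAbove) hi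
    (by rw [range_comp_succAbove]; exact hA.2 i)
  refine Or.inr ⟨i, s, hs, hi, fun j hj => ?_⟩
  -- Otherwise the entries of `A` other than `i` and `i.succAbove j` generate the complement.
  have hAi : s.1 (A i) ≠ A i := by
    refine fun h => s.closure_ne_top hN (g := A) (fun l => ?_) hA.1
    rcases Fin.eq_self_or_eq_succAbove i l with rfl | ⟨l, rfl⟩
    exacts [h, hs l]
  refine hA.2 (i.succAbove j) (s.eq_top_of_range_le hN ?_
    (subset_closure ⟨i, Fin.ne_succAbove i j, rfl⟩) hAi)
  rw [MonoidHom.range_eq_map, ← hj, MonoidHom.map_closure, ← Set.image_comp]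
  refine closure_mono ?_
  rintro _ ⟨l, hl, rfl⟩
  exact ⟨i.succAbove l, fun h => hl (Fin.succAbove_right_injective h), (hs l).symm⟩

theorem closure_range_eq_top_of_isEmpty {ι : Type*} (hN : IsAbelianMinimal N)
    [IsEmpty (Splitting N)] {f : ι → G} (hf : closure (Set.range (QuotientGroup.mk' N ∘ f)) = ⊤) :
    closure (Set.range f) = ⊤ := by
  by_contra h
  exact IsEmpty.false (exists_splitting hN hf h).choose

theorem mk_comp_section {ι : Type*} (s : Splitting N) (y : ι → G ⧸ N) :
    QuotientGroup.mk' N ∘ s.1 ∘ y = y :=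
  funext fun i => s.2 (y i)

theorem mk_comp_out {ι : Type*} (y : ι → G ⧸ N) :
    QuotientGroup.mk' N ∘ Quotient.out ∘ y = y :=
  funext fun i => QuotientGroup.out_eq' (y i)

end Extension

/-! ### The lengths of minimal generating tuples -/

/-- Some minimal generating tuple of `G` has length `k`. -/
def HasMinGen (k : ℕ) (G : Type*) [Group G] : Prop := ∃ g : Fin k → G, IsMinGen g

theorem IsMinGen.length_eq_zero {G : Type*} [Group G] [Subsingleton G] {k : ℕ} {g : Fin k → G}
    (hg : IsMinGen g) : k = 0 := by
  by_contra h
  exact hg.2 ⟨0, Nat.pos_of_ne_zero h⟩ (Subsingleton.elim _ _)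

theorem HasMinGen.pos {G : Type*} [Group G] [Nontrivial G] {k : ℕ} (h : HasMinGen k G) :
    0 < k := by
  obtain ⟨g, hg⟩ := h
  rw [Nat.pos_iff_ne_zero]
  rintro rfl
  have := hg.1
  rw [Set.range_eq_empty, Subgroup.closure_empty] at this
  exact bot_ne_top this

section HasMinGen

variable {G : Type*} [Group G] {N : Subgroup G} [N.Normal] {k : ℕ}

theorem HasMinGen.succ (hN : IsAbelianMinimal N) (s : Splitting N) (h : HasMinGen k (G ⧸ N)) :
    HasMinGen (k + 1) G := by
  obtain ⟨y, hy⟩ := h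
  obtain ⟨n, hn, hn1⟩ := hN.exists_ne_one
  exact ⟨_, hy.cons hN s hn hn1⟩

theorem HasMinGen.mk_or (hN : IsAbelianMinimal N) (h : HasMinGen (k + 1) G) :
    HasMinGen (k + 1) (G ⧸ N) ∨ Nonempty (Splitting N) ∧ HasMinGen k (G ⧸ N) := by
  obtain ⟨A, hA⟩ := h
  rcases hA.mk_or hN with h | ⟨i, s, -, h⟩
  exacts [Or.inl ⟨_, h⟩, Or.inr ⟨⟨s⟩, _, h⟩]

end HasMinGen

universe v

/-- Induction along a chief series. -/
theorem solvable_induction {P : ∀ (G : Type v) [Group G], Prop}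
    (subsingleton : ∀ (G : Type v) [Group G] [Subsingleton G], P G)
    (extension : ∀ (G : Type v) [Group G] [Finite G] [Nontrivial G], Group.IsSolvable G →
      ∀ (N : Subgroup G) [N.Normal], IsAbelianMinimal N → P (G ⧸ N) → P G)
    (G : Type v) [Group G] [Finite G] (hG : Group.IsSolvable G) : P G := by
  induction h : Nat.card G using Nat.strong_induction_on generalizing G with
  | _ n ih =>
    rcases subsingleton_or_nontrivial G with h1 | h1
    · exact subsingleton G
    · obtain ⟨N, hn, hN⟩ := exists_isAbelianMinimal hG
      refine extension G hG N hN (ih _ ?_ (G ⧸ N) inferInstance rfl)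
      rw [← h, card_eq_card_quotient_mul_card_subgroup N]
      have h2 : 1 < Nat.card N := (one_lt_card_iff_ne_bot N).2 hN.ne_bot
      exact lt_mul_of_one_lt_right Nat.card_pos h2

/-- The lengths of the minimal generating tuples of a soluble group form an interval (Tarski proved
this for all groups). -/
theorem HasMinGen.of_le_of_le {G : Type*} [Group G] [Finite G] (hG : Group.IsSolvable G)
    {a k b : ℕ} (hak : a ≤ k) (hkb : k ≤ b) (ha : HasMinGen a G) (hb : HasMinGen b G) :
    HasMinGen k G := by
  suffices H : ∀ a k b : ℕ, a ≤ k → k ≤ b → HasMinGen a G → HasMinGen b G → HasMinGen k G from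
    H a k b hak hkb ha hb
  clear hak hkb ha hb
  refine solvable_induction (P := fun G _ => ∀ a k b : ℕ, a ≤ k → k ≤ b →
    HasMinGen a G → HasMinGen b G → HasMinGen k G) ?_ ?_ G hG
  · rintro G _ _ a k b hak hkb ha ⟨g, hg⟩
    have := hg.length_eq_zero
    obtain rfl : a = k := by omega
    exact ha
  · intro G _ _ _ hG N _ hN ih a k b hak hkb ha hb
    rcases hak.eq_or_lt with rfl | hlt
    · exact ha
    obtain ⟨a, rfl⟩ := Nat.exists_eq_add_of_le' ha.pos
    obtain ⟨b, rfl⟩ := Nat.exists_eq_add_of_le' hb.pos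
    obtain ⟨k, rfl⟩ := Nat.exists_eq_add_of_le' (ha.pos.trans hlt)
    rcases isEmpty_or_nonempty (Splitting N) with hs | ⟨⟨s⟩⟩
    · have ha' := (ha.mk_or hN).resolve_right fun h => not_isEmpty_of_nonempty _ (h := h.1) hs
      have hb' := (hb.mk_or hN).resolve_right fun h => not_isEmpty_of_nonempty _ (h := h.1) hs
      obtain ⟨y, hy⟩ := ih _ (k + 1) _ hak hkb ha' hb'
      rw [← mk_comp_out y] at hy
      exact ⟨_, hy.of_lift rfl (closure_range_eq_top_of_isEmpty hN hy.1)⟩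
    · refine HasMinGen.succ hN s ?_
      rcases ha.mk_or hN with ha' | ⟨-, ha'⟩ <;> rcases hb.mk_or hN with hb' | ⟨-, hb'⟩ <;>
        exact ih _ k _ (by omega) (by omega) ha' hb'

/-- If a soluble group has minimal generating tuples of lengths `k` and `k + 1`, where `2 ≤ k`,
then two such tuples have a common entry. Tuples made of a minimal generating tuple of a complement
and a fixed nontrivial element of `N` share that element. The main case is a tuple `A` of length `k`
that stays minimal modulo `N`: a complement that contains an entry of `A` is generated by a tuple
with that entry. The case in which `G ⧸ N` has no minimal generating tuple of length `k` is excluded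
because the lengths form an interval. -/
theorem exists_common_entry {G : Type*} [Group G] [Finite G] (hG : Group.IsSolvable G) {k : ℕ}
    (hk : 2 ≤ k) (h₁ : HasMinGen k G) (h₂ : HasMinGen (k + 1) G) :
    ∃ (g : Fin k → G) (g' : Fin (k + 1) → G), IsMinGen g ∧ IsMinGen g' ∧ ∃ i j, g i = g' j := by
  revert h₁ h₂
  refine solvable_induction (P := fun G _ => HasMinGen k G → HasMinGen (k + 1) G →
    ∃ (g : Fin k → G) (g' : Fin (k + 1) → G),
      IsMinGen g ∧ IsMinGen g' ∧ ∃ i j, g i = g' j) ?_ ?_ G hG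
  · rintro G _ _ ⟨g, hg⟩ -
    have := hg.length_eq_zero
    omega
  · intro G _ _ _ hG N _ hN ih h₁ h₂
    obtain ⟨k, rfl⟩ := Nat.exists_eq_add_of_le' (one_le_two.trans hk)
    rcases isEmpty_or_nonempty (Splitting N) with hs | ⟨⟨s⟩⟩
    · have h₁' := (h₁.mk_or hN).resolve_right fun h => not_isEmpty_of_nonempty _ (h := h.1) hs
      have h₂' := (h₂.mk_or hN).resolve_right fun h => not_isEmpty_of_nonempty _ (h := h.1) hs
      obtain ⟨y, y', hy, hy', i, j, hij⟩ := ih h₁' h₂'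
      rw [← mk_comp_out y] at hy
      rw [← mk_comp_out y'] at hy'
      exact ⟨_, _, hy.of_lift rfl (closure_range_eq_top_of_isEmpty hN hy.1),
        hy'.of_lift rfl (closure_range_eq_top_of_isEmpty hN hy'.1), i, j, congrArg Quotient.out hij⟩
    obtain ⟨n, hn, hn1⟩ := hN.exists_ne_one
    obtain ⟨A, hA⟩ := h₁
    by_cases h : HasMinGen (k + 1) (G ⧸ N)
    · rcases hA.mk_or hN with hA' | ⟨i, t, -, hA'⟩
      · by_cases hex : ∃ (t : Splitting N) (j : Fin (k + 1)), t.1 (A j) = A j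
        · obtain ⟨t, j, htj⟩ := hex
          exact ⟨A, _, hA, hA'.cons hN t hn hn1, j, j.succ, htj.symm⟩
        · -- No entry of `A` lies in a complement; all entries but the first can thus be moved into
          -- the range of `s`.
          push Not at hex
          let g : Fin (k + 1) → G := fun p => if p = 0 then A 0 else s.1 (A p)
          have hg : QuotientGroup.mk' N ∘ g = QuotientGroup.mk' N ∘ A := by
            funext p
            by_cases hp : p = 0
            · simp [g, hp]
            · simp [g, hp, s.2]
          have hgen : closure (Set.range g) = ⊤ := by
            by_contra hne
            obtain ⟨t, ht⟩ := exists_splitting hN (hg ▸ hA'.1) hne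
            exact hex t 0 (ht 0)
          have hlast : Fin.last k ≠ 0 := by
            rw [Ne, Fin.ext_iff, Fin.val_last, Fin.val_zero]
            omega
          exact ⟨g, _, hA'.of_lift hg hgen, hA'.cons hN s hn hn1, Fin.last k, (Fin.last k).succ,
            if_neg hlast⟩
      · obtain ⟨y, hy⟩ := h
        exact ⟨_, _, hA'.cons hN t hn hn1, hy.cons hN s hn hn1, 0, 0, rfl⟩
    · exfalso
      have h₁' := ((HasMinGen.mk_or hN ⟨A, hA⟩).resolve_left h).2
      have h₂' := (h₂.mk_or hN).resolve_right fun h' => h h'.2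
      exact h (h₁'.of_le_of_le (k := k + 1) inferInstance (by omega) (by omega) h₂')

/-! ### Linking minimal generating tuples of an extension -/

section Linking

variable {G : Type*} [Group G] {N : Subgroup G} [N.Normal] {k : ℕ}

theorem exists_lift_iff_card_splitting_lt [Finite G] (hN : IsAbelianMinimal N) {f : Fin k → G}
    (hf : closure (Set.range (QuotientGroup.mk' N ∘ f)) = ⊤) :
    (∃ g : Fin k → G, QuotientGroup.mk' N ∘ g = QuotientGroup.mk' N ∘ f ∧
      closure (Set.range g) = ⊤) ↔ Nat.card (Splitting N) < Nat.card N ^ k := by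
  have h := exists_lift_iff hN hf ∅
  have h1 : Nat.card ((∅ : Set (Fin k))ᶜ : Set (Fin k)) = k := by simp
  have h2 : Nat.card {s : Splitting N // ∀ j ∈ (∅ : Set (Fin k)), s.1 (f j) = f j} =
      Nat.card (Splitting N) :=
    Nat.card_congr (Equiv.subtypeUnivEquiv fun s j hj => absurd hj (Set.notMem_empty j))
  rw [h1, h2] at h
  rw [← h]
  simp

theorem exists_lift_fixing_iff [Finite G] (hN : IsAbelianMinimal N) {f : Fin k → G}
    (hf : closure (Set.range (QuotientGroup.mk' N ∘ f)) = ⊤) (i : Fin k) :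
    (∃ g : Fin k → G, QuotientGroup.mk' N ∘ g = QuotientGroup.mk' N ∘ f ∧ g i = f i ∧
      closure (Set.range g) = ⊤) ↔
    Nat.card {s : Splitting N // s.1 (f i) = f i} < Nat.card N ^ (k - 1) := by
  have h := exists_lift_iff hN hf {i}
  have h1 : Nat.card (({i} : Set (Fin k))ᶜ : Set (Fin k)) = k - 1 := by
    rw [Nat.card_coe_set_eq, Set.ncard_compl, Set.ncard_singleton, Nat.card_fin]
  simpa only [h1, Set.mem_singleton_iff, forall_eq] using h

/-- Entries of two generating lifts of one minimal generating tuple of `G ⧸ N` are linked. -/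
theorem linked_of_lifts (hN : IsAbelianMinimal N) (hk : 2 ≤ k)
    (h : IsEmpty (Splitting N) ∨ 3 ≤ k ∨ ∀ z : G, closure {z} ≠ ⊤) {v w : Fin k → G}
    (hmin : IsMinGen (QuotientGroup.mk' N ∘ v))
    (hvw : QuotientGroup.mk' N ∘ w = QuotientGroup.mk' N ∘ v)
    (hv : closure (Set.range v) = ⊤) (hw : closure (Set.range w) = ⊤) (i : Fin k) :
    MinGenLinked k (v i) (w i) := by
  obtain ⟨j, hji⟩ : ∃ j : Fin k, j ≠ i :=
    Fintype.exists_ne_of_one_lt_card (by simp; omega) i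
  rcases h with h | h | h
  · have hmk : ∀ p, (w p : G ⧸ N) = v p := fun p => congrFun hvw p
    let g : Fin k → G := fun p => if p = i then w i else v p
    have hg : QuotientGroup.mk' N ∘ g = QuotientGroup.mk' N ∘ v := by
      funext p
      by_cases hp : p = i
      · simp [g, hp, hmk]
      · simp [g, hp]
    have hg' := hmin.of_lift hg (closure_range_eq_top_of_isEmpty hN (hg ▸ hmin.1))
    have h1 := hg'.linked j i
    simp only [g, hji, if_true, if_false] at h1
    exact ((hmin.of_lift rfl hv).linked i j).trans h1
  · exact linked_of_three_le hN h hmin hvw hv hw i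
  · rcases hk.eq_or_lt with rfl | hk
    · have hr : ∀ u : Fin 2 → G, Set.range u = {u i, u j} := by
        intro u
        have : ∀ l : Fin 2, l = i ∨ l = j := by lia
        ext x
        constructor
        · rintro ⟨l, rfl⟩
          rcases this l with rfl | rfl <;> simp
        · rintro (rfl | rfl) <;> simp
      exact linked_of_pair hN h (congrFun hvw i).symm (congrFun hvw j).symm (hr v ▸ hv)
        (hr w ▸ hw)
    · exact linked_of_three_le hN hk hmin hvw hv hw i

/-- All minimal generating tuples that do not remain minimal modulo `N` are linked to any given
nontrivial element of `N`. -/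
theorem linked_of_not_isMinGen_mk (hN : IsAbelianMinimal N) {A : Fin (k + 2) → G}
    (hA : IsMinGen A) (hA' : ¬ IsMinGen (QuotientGroup.mk' N ∘ A)) {n : G} (hn : n ∈ N)
    (hn1 : n ≠ 1) (i : Fin (k + 2)) : MinGenLinked (k + 2) (A i) n := by
  obtain ⟨l, s, hs, hmin⟩ := (hA.mk_or hN).resolve_left hA'
  have h := (hmin.cons hN s hn hn1).linked (Fin.succ 0) 0
  refine (hA.linked i (l.succAbove 0)).trans ?_
  have h1 := hs 0
  simp only [Fin.cons_succ, Fin.cons_zero, Function.comp_apply, QuotientGroup.mk'_apply, h1] at h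
  exact h

variable [Finite G]

/-- By Gaschütz's lemma, an entry of a generating lift of one minimal generating tuple of `G ⧸ N` is
also an entry of a generating lift of any other such tuple that contains its image. -/
theorem linked_of_mk_eq (hN : IsAbelianMinimal N) (hk : 2 ≤ k)
    (h : IsEmpty (Splitting N) ∨ 3 ≤ k ∨ ∀ z : G, closure {z} ≠ ⊤) {A B : Fin k → G}
    (hA : IsMinGen (QuotientGroup.mk' N ∘ A)) (hB : IsMinGen (QuotientGroup.mk' N ∘ B))
    (hA' : closure (Set.range A) = ⊤) (hB' : closure (Set.range B) = ⊤) {i j : Fin k}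
    (hij : (A i : G ⧸ N) = B j) : MinGenLinked k (A i) (B j) := by
  have hcard := (exists_lift_fixing_iff hN hB.1 j).1 ⟨B, rfl, rfl, hB'⟩
  have hf : QuotientGroup.mk' N ∘ Function.update A i (B j) = QuotientGroup.mk' N ∘ A := by
    rw [Function.comp_update, QuotientGroup.mk'_apply, ← hij]
    exact Function.update_eq_self i _
  obtain ⟨C, hC, hCi, hCgen⟩ :=
    (exists_lift_fixing_iff hN (f := Function.update A i (B j)) (hf ▸ hA.1) i).2
      (by simpa using hcard)
  rw [Function.update_self] at hCi
  exact hCi ▸ linked_of_lifts hN hk h hA (hC.trans hf) hA' hCgen i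

/-- Chains of minimal generating tuples of `G ⧸ N` lift to `G`. -/
theorem linked_of_linked_mk (hN : IsAbelianMinimal N) (hk : 2 ≤ k)
    (h : IsEmpty (Splitting N) ∨ 3 ≤ k ∨ ∀ z : G, closure {z} ≠ ⊤) {A B : Fin k → G}
    (hA : IsMinGen (QuotientGroup.mk' N ∘ A)) (hB : IsMinGen (QuotientGroup.mk' N ∘ B))
    (hA' : closure (Set.range A) = ⊤) (hB' : closure (Set.range B) = ⊤) {i j : Fin k}
    (hij : MinGenLinked k (A i : G ⧸ N) (B j)) : MinGenLinked k (A i) (B j) := by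
  suffices H : ∀ q : G ⧸ N, MinGenLinked k (A i : G ⧸ N) q → ∀ (B : Fin k → G) (j : Fin k),
      IsMinGen (QuotientGroup.mk' N ∘ B) → closure (Set.range B) = ⊤ → (B j : G ⧸ N) = q →
      MinGenLinked k (A i) (B j) from H _ hij B j hB hB' rfl
  clear! B
  intro q hq
  induction hq with
  | refl => exact fun B j hB hB' hj => linked_of_mk_eq hN hk h hA hB hA' hB' hj.symm
  | tail _ hadj ih =>
    intro B j hB hB' hj
    obtain ⟨y, hy, ⟨l, rfl⟩, ⟨l', rfl⟩⟩ := hadj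
    rw [← mk_comp_out y] at hy
    obtain ⟨C, hC, hCgen⟩ := (exists_lift_iff_card_splitting_lt hN hy.1).2
      ((exists_lift_iff_card_splitting_lt hN hA.1).1 ⟨A, rfl, hA'⟩)
    have hCmin : IsMinGen (QuotientGroup.mk' N ∘ C) := hC ▸ hy
    rw [mk_comp_out] at hC
    refine (ih C l hCmin hCgen (congrFun hC l)).trans
      (((hCmin.of_lift rfl hCgen).linked l l').trans ?_)
    exact linked_of_mk_eq hN hk h hCmin hB hCgen hB' ((congrFun hC l').trans hj.symm)

/-- Let `s ∘ y` be a minimal generating tuple of a complement of `N`. An entry `A j` outside the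
complement completes it to a minimal generating tuple linked to `N`, unless `G` is generated by
fewer elements. In that case Gaschütz's lemma gives lifts of a tuple `g'` that contain a prescribed
lift of one of its entries, and `exists_common_entry` provides a suitable `g'`. -/
theorem exists_linked_of_isMinGen_mk (hG : Group.IsSolvable G) (hN : IsAbelianMinimal N)
    (s : Splitting N) (hy : HasMinGen (k + 1) (G ⧸ N)) {A : Fin (k + 2) → G}
    (hA : IsMinGen (QuotientGroup.mk' N ∘ A)) (hA' : closure (Set.range A) = ⊤) {n : G}
    (hn : n ∈ N) (hn1 : n ≠ 1) :
    (∃ j, MinGenLinked (k + 2) (A j) n) ∨ (0 < k ∧ ∃ C : Fin (k + 2) → G,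
      IsMinGen (QuotientGroup.mk' N ∘ C) ∧ closure (Set.range C) = ⊤ ∧
      ∃ j, MinGenLinked (k + 2) (C j) n) := by
  obtain ⟨y, hy⟩ := hy
  obtain ⟨j, hj⟩ : ∃ j, s.1 (A j) ≠ A j := by
    by_contra! h
    exact s.closure_ne_top hN h hA'
  rcases isMinGen_cons_or hN s hy hj with h | ⟨l, hl⟩
  · have h1 := h.linked 0 (Fin.succ 0)
    have h2 := (hy.cons hN s hn hn1).linked (Fin.succ 0) 0
    exact Or.inl ⟨j, MinGenLinked.trans h1 h2⟩
  refine Or.inr ?_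
  have hk : 0 < k := by
    rw [Nat.pos_iff_ne_zero]
    rintro rfl
    -- Here `A j` alone generates `G`, although `A` has two entries.
    obtain ⟨i, hi⟩ : ∃ i : Fin 2, i ≠ j := Fintype.exists_ne_of_one_lt_card (by simp) j
    refine (hA.of_lift rfl hA').2 i (top_unique (hl ▸ closure_mono ?_))
    rintro _ ⟨p, hp, rfl⟩
    have hp0 : p = 0 := by
      have hp' : p ≠ l.succ := hp
      rw [show l = 0 by lia] at hp'
      lia
    exact ⟨j, hi.symm, by rw [hp0]; rfl⟩
  rw [← range_comp_succAbove] at hl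
  have hcard := (exists_lift_iff_card_splitting_lt hN
    (closure_range_comp_eq_top (QuotientGroup.mk'_surjective N) hl)).1 ⟨_, rfl, hl⟩
  obtain ⟨g, g', hg, hg', p, p', hpp⟩ := exists_common_entry (G := G ⧸ N) inferInstance
    (k := k + 1) (by omega) ⟨y, hy⟩ ⟨_, hA⟩
  obtain ⟨C, hC, hCp, hCgen⟩ := (exists_lift_fixing_iff hN (f := s.1 ∘ g')
    (by rw [mk_comp_section]; exact hg'.1) p').2
    (lt_of_le_of_lt (Nat.card_le_card_of_injective _ Subtype.val_injective) hcard)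
  rw [mk_comp_section] at hC
  refine ⟨hk, C, hC ▸ hg', hCgen, p', ?_⟩
  rw [hCp, Function.comp_apply, ← hpp]
  exact (hg.cons hN s hn hn1).linked p.succ 0

end Linking

theorem linked_of_isMinGen {G : Type*} [Group G] [Finite G] (hG : Group.IsSolvable G) (k : ℕ)
    {A B : Fin (k + 2) → G} (hA : IsMinGen A) (hB : IsMinGen B) (i j : Fin (k + 2)) :
    MinGenLinked (k + 2) (A i) (B j) := by
  revert A B i j
  refine solvable_induction (P := fun G _ => ∀ {A B : Fin (k + 2) → G}, IsMinGen A → IsMinGen B →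
    ∀ i j, MinGenLinked (k + 2) (A i) (B j)) ?_ ?_ G hG
  · intro G _ _ A B hA
    exact absurd hA.length_eq_zero (by omega)
  intro G _ _ _ hG N _ hN ih
  by_cases hII : Nonempty (Splitting N) ∧ HasMinGen (k + 1) (G ⧸ N)
  · obtain ⟨⟨s⟩, hy⟩ := hII
    obtain ⟨n, hn, hn1⟩ := hN.exists_ne_one
    suffices H : ∀ A : Fin (k + 2) → G, IsMinGen A → ∀ i, MinGenLinked (k + 2) (A i) n from
      fun hA hB i j => (H _ hA i).trans (H _ hB j).symm
    intro A hA i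
    by_cases hA' : IsMinGen (QuotientGroup.mk' N ∘ A)
    · rcases exists_linked_of_isMinGen_mk hG hN s hy hA' hA.1 hn hn1 with
        ⟨j, hj⟩ | ⟨hk, C, hC, hCgen, j, hj⟩
      · exact (hA.linked i j).trans hj
      · exact (linked_of_linked_mk hN (by omega) (Or.inr (Or.inl (by omega))) hA' hC hA.1 hCgen
          (ih hA' hC i j)).trans hj
    · exact linked_of_not_isMinGen_mk hN hA hA' hn hn1 i
  · have hI : ∀ {A : Fin (k + 2) → G}, IsMinGen A → IsMinGen (QuotientGroup.mk' N ∘ A) :=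
      fun hA => (hA.mk_or hN).resolve_right fun ⟨_, s, _, h⟩ => hII ⟨⟨s⟩, _, h⟩
    intro hA hB i j
    refine linked_of_linked_mk hN (by omega) ?_ (hI hA) (hI hB) hA.1 hB.1 (ih (hI hA) (hI hB) i j)
    by_cases hs : IsEmpty (Splitting N)
    · exact Or.inl hs
    rw [not_isEmpty_iff] at hs
    refine Or.inr (or_iff_not_imp_left.2 fun hk z hz => hII ⟨hs, ?_⟩)
    obtain rfl : k = 0 := by omega
    -- The image of `z` is a minimal generating tuple of `G ⧸ N`, which is not trivial.
    refine ⟨QuotientGroup.mk' N ∘ fun _ => z,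
      closure_range_comp_eq_top (QuotientGroup.mk'_surjective N)
        (by rw [Set.range_const, hz]), fun l hl => (hI hA).2 0 (top_unique (hl ▸ ?_))⟩
    rw [closure_le]
    rintro _ ⟨m, hm, rfl⟩
    exact absurd (show m = l by lia) hm

/-! ### The graph -/

theorem isMinimalGeneratingSet_range_iff {G : Type*} [Group G] {k : ℕ} {g : Fin k → G}
    (hg : Function.Injective g) : IsMinimalGeneratingSet (Set.range g) ↔ IsMinGen g := by
  constructor
  · refine fun h => ⟨h.1, fun i => h.2 _ ⟨Set.image_subset_range _ _, fun hsub => ?_⟩⟩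
    obtain ⟨j, hj, hji⟩ := hsub ⟨i, rfl⟩
    exact hj (hg hji)
  · refine fun h => ⟨h.1, fun Y hY htop => ?_⟩
    obtain ⟨_, ⟨i, rfl⟩, hi⟩ := Set.exists_of_ssubset hY
    refine h.2 i (top_unique (htop ▸ closure_mono fun y hy => ?_))
    obtain ⟨j, rfl⟩ := hY.1 hy
    exact ⟨j, fun hj => hi (by rwa [← show j = i from hj]), rfl⟩

theorem minGenAdj_iff {G : Type*} [Group G] {k : ℕ} {x y : G} :
    MinGenAdj k x y ↔ ∃ X : Set G, IsMinimalGeneratingSet X ∧ X.encard = k ∧ x ∈ X ∧ y ∈ X := by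
  constructor
  · rintro ⟨g, hg, hx, hy⟩
    refine ⟨_, (isMinimalGeneratingSet_range_iff hg.injective).2 hg, ?_, hx, hy⟩
    rw [← Set.image_univ, hg.injective.encard_image, Set.encard_univ]
    simp
  · rintro ⟨X, hX, hcard, hx, hy⟩
    have hfin : X.Finite := Set.finite_of_encard_eq_coe hcard
    have hcard' : Nat.card X = k := by
      rw [Nat.card_coe_set_eq, Set.ncard_def, hcard, ENat.toNat_natCast]
    have := hfin.to_subtype
    let e := (Finite.equivFinOfCardEq hcard').symm
    have hr : Set.range (Subtype.val ∘ e) = X := by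
      rw [Set.range_comp, e.range_eq_univ, Set.image_univ, Subtype.range_val]
    refine ⟨Subtype.val ∘ e, ?_, hr.symm ▸ hx, hr.symm ▸ hy⟩
    rw [← isMinimalGeneratingSet_range_iff (Subtype.val_injective.comp e.injective), hr]
    exact hX

theorem independenceGraph_adj_iff {G : Type*} [Group G] {k : ℕ} {x y : G} :
    (independenceGraph k G).Adj x y ↔ x ≠ y ∧ MinGenAdj k x y := by
  rw [minGenAdj_iff]
  rfl

/-- For `2 ≤ k`, every element of a minimal generating set of size `k` has a neighbour in the set,
so that a chain of such sets is a walk among the non-isolated vertices. -/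
theorem MinGenLinked.reachable {G : Type*} [Group G] {k : ℕ} {x y : G}
    (h : MinGenLinked (k + 2) x y) (hx : x ∈ nonIsolatedVertices (k + 2) G) :
    ∃ hy : y ∈ nonIsolatedVertices (k + 2) G,
      (reducedIndependenceGraph (k + 2) G).Reachable ⟨x, hx⟩ ⟨y, hy⟩ := by
  induction h with
  | refl => exact ⟨hx, SimpleGraph.Reachable.refl _⟩
  | @tail b c _ hadj ih =>
    obtain ⟨hb, hr⟩ := ih
    by_cases hbc : b = c
    · subst hbc
      exact ⟨hb, hr⟩
    have hc : (independenceGraph (k + 2) G).Adj b c := independenceGraph_adj_iff.2 ⟨hbc, hadj⟩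
    exact ⟨⟨b, hc.symm⟩, hr.trans (SimpleGraph.Adj.reachable hc)⟩

theorem theorem2 {G : Type*} [Group G] [Finite G] (hG : Group.IsSolvable G) (u : ℕ) (hu : 0 < u) :
    (reducedIndependenceGraph u G).Preconnected := by
  rintro ⟨x, hx⟩ ⟨y, hy⟩
  obtain ⟨x', hxx, A, hA, ⟨i, rfl⟩, ⟨i', rfl⟩⟩ := hx.imp fun _ => independenceGraph_adj_iff.1
  obtain ⟨y', -, B, hB, ⟨j, rfl⟩, -⟩ := hy.imp fun _ => independenceGraph_adj_iff.1
  obtain ⟨k, rfl⟩ : ∃ k, u = k + 2 := by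
    refine Nat.exists_eq_add_of_le' ?_
    by_contra h
    obtain rfl : u = 1 := by omega
    exact hxx (congrArg A (Subsingleton.elim i i'))
  exact ((linked_of_isMinGen hG k hA hB i j).reachable hx).2
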